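/- For each $n\in\mathbb N$ let $\mathcal H_n$ be a finite-dimensional complex Hilbert space. For positive semidefinite operators $A_1,\dots,A_r$ on one such space, a POVM is a family $E_1,\dots,E_r$ of positive semidefinite operators with $E_1+\dots+E_r\le I$, and the optimal error probability is $$P_e^*(A_1,\dots,A_r)=\min\Big\{\sum_{i=1}^r\operatorname{Tr}A_i(I-E_i):\ \{E_1,\dots,E_r\}\text{ a POVM}\Big\}.$$ For sequences $\vec A_i=\{A_{i,n}\}_{n\in\mathbb N}$ of positive semidefinite operators $A_{i,n}$ on $\mathcal H_n$, put $$\overline p_e(\vec A_1,\dots,\vec A_r)=\limsup_{n\to\infty}\frac1n\log P_e^*(A_{1,n},\dots,A_{r,n})\in[-\infty,+\infty],$$ $$C(\vec A_i,\vec A_j)=-\limsup_{n\to\infty}\frac1n\log\min_{0\le s\le1}\operatorname{Tr}A_{i,n}^{s}A_{j,n}^{1-s},$$ where $\log 0=-\infty$ and powers of a positive semidefinite operator are taken on its support only (in particular $A^0$ is the projection onto the support of $A$). **Theorem.** Let $r\ge1$ and let $\vec A_1,\dots,\vec A_{r+1}$ be sequences of positive semidefinite operators, with $A_{i,n}$ acting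 on $\mathcal H_n$. Assume that $$\overline p_e(\vec A_1,\dots,\vec A_r)\le\max_{1\le i<j\le r}\overline p_e(\vec A_i,\vec A_j)$$ (a maximum over no pairs being $-\infty$), that $A_{r+1,n}$ has rank one for every $n$, and that $$\limsup_{n\to\infty}\frac1n\log\frac{\operatorname{Tr}\sum_{i=1}^rA_{i,n}}{\operatorname{Tr}A_{r+1,n}}=0.$$ Then $$\overline p_e(\vec A_1,\dots,\vec A_{r+1})\le\max_{1\le i<j\le r+1}\overline p_e(\vec A_i,\vec A_j)\le-\min_{1\le i<j\le r+1}C(\vec A_i,\vec A_j).$$ -/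

import Mathlib

open scoped ComplexOrder

namespace StateDiscrimination

noncomputable section

section SingleShot

variable {d : Type*} [Fintype d] [DecidableEq d]

/-- A (possibly incomplete) POVM on the Hilbert space `ℂ^d` with outcomes `κ`:
positive semidefinite operators `E k` with `∑ k, E k ≤ I`. -/
structure IsPOVM {κ : Type*} [Fintype κ] (E : κ → Matrix d d ℂ) : Prop where
  posSemidef : ∀ k, (E k).PosSemidef
  sum_le_one : (1 - ∑ k, E k).PosSemidef

/-- The error probability `∑ i, Tr A i (I - E i)` of the measurement `E` for the hypotheses `A`.
The trace is real for positive semidefinite `A i` and `I - E i`. -/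
def errorProb {κ : Type*} [Fintype κ] (A E : κ → Matrix d d ℂ) : ℝ :=
  ∑ i, (A i * (1 - E i)).trace.re

/-- The optimal error probability: the minimum of `errorProb A E` over all POVMs `E`. -/
def optError {κ : Type*} [Fintype κ] (A : κ → Matrix d d ℂ) : ℝ :=
  sInf {x : ℝ | ∃ E : κ → Matrix d d ℂ, IsPOVM E ∧ x = errorProb A E}

/-- The power `A ^ s` of a positive semidefinite operator, taken on its support only: the strictly
positive eigenvalues are raised to the power `s`, the kernel is kept (also for `s = 0`, so that
`A ^ 0` is the projection onto the support of `A`). -/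
def suppPow (A : Matrix d d ℂ) (s : ℝ) : Matrix d d ℂ :=
  cfc (fun x : ℝ => if 0 < x then x ^ s else 0) A

/-- `Q_s(A‖B) = Tr A ^ s B ^ (1 - s)`. -/
def chernoffQ (s : ℝ) (A B : Matrix d d ℂ) : ℝ :=
  (suppPow A s * suppPow B (1 - s)).trace.re

/-- `Q_min(A, B)`, the minimum of `Q_s(A‖B)` over `0 ≤ s ≤ 1`. -/
def chernoffQmin (A B : Matrix d d ℂ) : ℝ :=
  sInf ((fun s : ℝ => chernoffQ s A B) '' Set.Icc 0 1)

end SingleShot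

section Asymptotic

variable {d : ℕ → Type*} [∀ n, Fintype (d n)] [∀ n, DecidableEq (d n)]

/-- The exponent `limsup (1 / n) log P_e^*(A 1 n, …, A r n)`, with `log 0 = -∞`. -/
def upperExponent {κ : Type*} [Fintype κ] (A : κ → ∀ n, Matrix (d n) (d n) ℂ) : EReal :=
  ExpGrowth.expGrowthSup fun n => ENNReal.ofReal (optError fun i => A i n)

/-- The exponent of the binary problem with the hypotheses `A` and `B`. -/
def pairExponent (A B : ∀ n, Matrix (d n) (d n) ℂ) : EReal :=
  upperExponent ![A, B]

/-- The regularized Chernoff divergence `- limsup (1 / n) log Q_min(A n, B n)`. -/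
def chernoffDiv (A B : ∀ n, Matrix (d n) (d n) ℂ) : EReal :=
  -ExpGrowth.expGrowthSup fun n => ENNReal.ofReal (chernoffQmin (A n) (B n))

/-- The worst pairwise exponent (a maximum over finitely many pairs). -/
def maxPairExponent {r : ℕ} (A : Fin r → ∀ n, Matrix (d n) (d n) ℂ) : EReal :=
  ⨆ (i : Fin r) (j : Fin r) (_ : i < j), pairExponent (A i) (A j)

/-- The least pairwise Chernoff divergence (a minimum over finitely many pairs). -/
def minChernoffDiv {r : ℕ} (A : Fin r → ∀ n, Matrix (d n) (d n) ℂ) : EReal :=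
  ⨅ (i : Fin r) (j : Fin r) (_ : i < j), chernoffDiv (A i) (A j)

end Asymptotic

end

end StateDiscrimination

namespace StateDiscrimination

open Matrix

/-! ### Trace inequalities and a converse for binary tests -/

section Trace

variable {d : Type*} [Fintype d]

/-! A rank-one last hypothesis is a scalar multiple of a projection `P`. Measure `P` first; on the
complement, compress a given POVM for the other hypotheses by `1 - P`. The last hypothesis then
incurs no error, and the others pay a factor 2 plus the disturbance `3 Tr A_i P`
(`optError_snoc_le`). This overlap is controlled by a converse, `trace_mul_re_le_of_test`: operators
that some test separates well are nearly orthogonal, so `Tr A_i P` is at most the pair error times a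
ratio of traces, and the trace assumption makes that ratio subexponential. The second inequality is
the single-shot quantum Chernoff bound, `optError_pair_le_chernoffQmin`, which rests on operator
monotonicity of powers. -/

theorem trace_conjTranspose_mul_self_re (M : Matrix d d ℂ) :
    (Mᴴ * M).trace.re = ∑ i, ∑ j, ‖M i j‖ ^ 2 := by
  rw [Finset.sum_comm]
  simp [trace, mul_apply, ← Complex.normSq_eq_conj_mul_self, Complex.normSq_eq_norm_sq,
    -Complex.ofReal_pow]

theorem _root_.Matrix.PosSemidef.trace_re_nonneg {X : Matrix d d ℂ} (hX : X.PosSemidef) :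
    0 ≤ X.trace.re :=
  (Complex.le_def.mp hX.trace_nonneg).1

variable [DecidableEq d]

open scoped MatrixOrder Matrix.Norms.L2Operator in
theorem exists_eq_conjTranspose_mul_self {X : Matrix d d ℂ} (hX : X.PosSemidef) :
    ∃ C : Matrix d d ℂ, X = Cᴴ * C :=
  CStarAlgebra.nonneg_iff_eq_star_mul_self.mp hX.nonneg

theorem trace_mul_re_nonneg {X Y : Matrix d d ℂ} (hX : X.PosSemidef) (hY : Y.PosSemidef) :
    0 ≤ (X * Y).trace.re := by
  obtain ⟨C, rfl⟩ := exists_eq_conjTranspose_mul_self hY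
  rw [← Matrix.mul_assoc, trace_mul_comm, ← Matrix.mul_assoc]
  exact (hX.mul_mul_conjTranspose_same C).trace_re_nonneg

theorem trace_mul_re_mono {X Y Z : Matrix d d ℂ} (hX : X.PosSemidef) (h : (Z - Y).PosSemidef) :
    (X * Y).trace.re ≤ (X * Z).trace.re := by
  have := trace_mul_re_nonneg hX h
  rw [Matrix.mul_sub, trace_sub, Complex.sub_re] at this
  linarith

open scoped Matrix.Norms.Frobenius in
-- Submultiplicativity of the Frobenius norm, applied to square-root factors of `X` and `Y`.
theorem trace_mul_re_le {X Y : Matrix d d ℂ} (hX : X.PosSemidef) (hY : Y.PosSemidef) :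
    (X * Y).trace.re ≤ X.trace.re * Y.trace.re := by
  have key (M : Matrix d d ℂ) : (Mᴴ * M).trace.re = ‖M‖ ^ 2 := by
    rw [trace_conjTranspose_mul_self_re, frobenius_norm_def, ← Real.sqrt_eq_rpow,
      Real.sq_sqrt (by positivity)]
    simp
  obtain ⟨A, rfl⟩ := exists_eq_conjTranspose_mul_self hX
  obtain ⟨B, rfl⟩ := exists_eq_conjTranspose_mul_self hY
  have h : (Aᴴ * A * (Bᴴ * B)).trace = ((A * Bᴴ)ᴴ * (A * Bᴴ)).trace := by
    rw [trace_mul_comm, conjTranspose_mul, conjTranspose_conjTranspose, Matrix.mul_assoc Bᴴ,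
      trace_mul_comm]
    simp only [Matrix.mul_assoc]
  rw [h, key, key, key, ← mul_pow, ← frobenius_norm_conjTranspose B]
  gcongr
  exact frobenius_norm_mul _ _

/-- `T - T² = T(1 - T)T + (1 - T)T(1 - T)`. -/
theorem _root_.Matrix.PosSemidef.sub_sq {T : Matrix d d ℂ} (hT : T.PosSemidef)
    (hT' : (1 - T).PosSemidef) : (T - T * T).PosSemidef := by
  have h1 := hT'.conjTranspose_mul_mul_same T
  have h2 := hT.conjTranspose_mul_mul_same (1 - T)
  rw [hT.isHermitian.eq] at h1
  rw [hT'.isHermitian.eq] at h2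
  convert h1.add h2 using 1
  noncomm_ring

/-- Parallelogram identity, with the nonnegative term in `S - T` dropped. -/
theorem trace_mul_conj_add_le {X F S T : Matrix d d ℂ} (hX : X.PosSemidef) (hF : F.PosSemidef)
    (hS : S.IsHermitian) (hT : T.IsHermitian) :
    (X * ((S + T) * F * (S + T))).trace.re ≤
      2 * (X * (S * F * S)).trace.re + 2 * (X * (T * F * T)).trace.re := by
  have h := trace_mul_re_nonneg hX (hF.conjTranspose_mul_mul_same (S - T))
  rw [(hS.sub hT).eq] at h
  have e : (S + T) * F * (S + T) + (S - T) * F * (S - T) =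
      S * F * S + S * F * S + (T * F * T + T * F * T) := by
    noncomm_ring
  have := congrArg (fun Z => (X * Z).trace.re) e
  simp only [Matrix.mul_add X, trace_add, Complex.add_re] at this
  linarith

/-- A quantitative converse: if `A` and `B` are well distinguished by `T`, then they are nearly
orthogonal. -/
theorem trace_mul_re_le_of_test {A B T : Matrix d d ℂ} (hA : A.PosSemidef) (hB : B.PosSemidef)
    (hT : T.PosSemidef) (hT' : (1 - T).PosSemidef) :
    (A * B).trace.re ≤
      2 * (A.trace.re + B.trace.re) * ((A * T).trace.re + (B * (1 - T)).trace.re) := by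
  have conj {X Y S : Matrix d d ℂ} (hX : X.PosSemidef) (hY : Y.PosSemidef) (hS : S.PosSemidef)
      (hS' : (1 - S).PosSemidef) :
      (X * (S * Y * S)).trace.re ≤ (X * S).trace.re * Y.trace.re := by
    have h1 : (X * (S * Y * S)).trace = ((S * X * S) * Y).trace := by
      rw [← Matrix.mul_assoc, trace_mul_comm]
      simp only [Matrix.mul_assoc]
    have h2 : (S * X * S).PosSemidef := by
      simpa [hS.isHermitian.eq] using hX.conjTranspose_mul_mul_same S
    have h3 : (S * X * S).trace = (X * (S * S)).trace := by
      rw [trace_mul_comm, ← Matrix.mul_assoc, trace_mul_comm]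
    rw [h1]
    refine (trace_mul_re_le h2 hY).trans ?_
    rw [h3]
    exact mul_le_mul_of_nonneg_right (trace_mul_re_mono hX (hS.sub_sq hS')) hY.trace_re_nonneg
  have h0 := conj hA hB hT hT'
  have h1 : (A * ((1 - T) * B * (1 - T))).trace.re ≤ (B * (1 - T)).trace.re * A.trace.re := by
    refine le_trans (le_of_eq ?_) (conj hB hA hT' (by simpa using hT))
    rw [trace_mul_comm B, ← Matrix.mul_assoc A, trace_mul_comm _ (1 - T)]
    simp only [Matrix.mul_assoc]
  have hp1 := mul_nonneg hA.trace_re_nonneg (trace_mul_re_nonneg hA hT)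
  have hp2 := mul_nonneg hB.trace_re_nonneg (trace_mul_re_nonneg hB hT')
  -- Since `T + (1 - T) = 1`, the left side is `Tr AB`.
  have h2 := trace_mul_conj_add_le hA hB hT.isHermitian hT'.isHermitian
  rw [add_sub_cancel, Matrix.one_mul, Matrix.mul_one] at h2
  nlinarith

end Trace

/-! ### Powers on the support and the Chernoff trace inequality -/

section Powers

variable {d : Type*} [Fintype d] [DecidableEq d]

theorem continuousOn_spectrum (f : ℝ → ℝ) (A : Matrix d d ℂ) : ContinuousOn f (spectrum ℝ A) :=
  (Matrix.finite_real_spectrum (A := A)).continuousOn f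

open scoped MatrixOrder

theorem suppPow_posSemidef (A : Matrix d d ℂ) (s : ℝ) : (suppPow A s).PosSemidef :=
  (cfc_nonneg fun x _ => by split_ifs <;> positivity).posSemidef

theorem one_sub_suppPow_zero_posSemidef (A : Matrix d d ℂ) : (1 - suppPow A 0).PosSemidef :=
  Matrix.le_iff.mp (cfc_le_one (fun x : ℝ => if 0 < x then x ^ (0 : ℝ) else 0) A
    fun x _ => by split_ifs <;> simp)

theorem suppPow_one {A : Matrix d d ℂ} (hA : A.PosSemidef) : suppPow A 1 = A := by
  conv_rhs => rw [← cfc_id ℝ A hA.isHermitian]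
  refine cfc_congr fun x hx => ?_
  have : 0 ≤ x := spectrum_nonneg_of_nonneg hA.nonneg hx
  rcases this.eq_or_lt with rfl | h
  · simp
  · simp [h]

theorem mul_suppPow_zero {A : Matrix d d ℂ} (hA : IsSelfAdjoint A) :
    A * suppPow A 0 = cfc (fun x : ℝ => max x 0) A := by
  conv_lhs => enter [1]; rw [← cfc_id ℝ A hA]
  rw [suppPow, ← cfc_mul _ _ A (continuousOn_spectrum _ _) (continuousOn_spectrum _ _)]
  refine cfc_congr fun x _ => ?_
  rcases lt_or_ge 0 x with h | h
  · simp [h, h.le]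
  · simp [h, h.not_gt]

theorem posSemidef_mul_suppPow_zero {A : Matrix d d ℂ} (hA : A.IsHermitian) :
    (A * suppPow A 0).PosSemidef := by
  rw [mul_suppPow_zero hA]
  exact (cfc_nonneg fun x _ => le_max_right x 0).posSemidef

theorem posSemidef_mul_suppPow_zero_sub {A : Matrix d d ℂ} (hA : A.IsHermitian) :
    (A * suppPow A 0 - A).PosSemidef := by
  rw [mul_suppPow_zero hA]
  conv => enter [1, 2]; rw [← cfc_id ℝ A hA]
  exact Matrix.le_iff.mp (cfc_mono (fun x _ => le_max_left x 0) (continuousOn_spectrum _ _)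
    (continuousOn_spectrum _ _))

open scoped Matrix.Norms.L2Operator in
-- At `s = 0` the two differ: `A ^ 0` is the identity, not the support projection. Hence the
-- endpoints of the Chernoff bound are treated separately.
theorem suppPow_eq_rpow {A : Matrix d d ℂ} (hA : A.PosSemidef) {s : ℝ} (hs : 0 < s) :
    suppPow A s = A ^ s := by
  rw [CFC.rpow_eq_cfc_real hA.nonneg]
  refine cfc_congr fun x hx => ?_
  have : 0 ≤ x := spectrum_nonneg_of_nonneg hA.nonneg hx
  rcases this.eq_or_lt with rfl | h
  · simp [hs.ne']
  · simp [h]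

open scoped Matrix.Norms.L2Operator in
theorem suppPow_mono {A B : Matrix d d ℂ} (hA : A.PosSemidef) (h : (B - A).PosSemidef) {s : ℝ}
    (hs : 0 < s) (hs' : s ≤ 1) : (suppPow B s - suppPow A s).PosSemidef := by
  have hB : B.PosSemidef := by simpa using h.add hA
  rw [suppPow_eq_rpow hA hs, suppPow_eq_rpow hB hs]
  exact CFC.rpow_le_rpow ⟨hs.le, hs'⟩ (Matrix.le_iff.mpr h)

theorem suppPow_mul_suppPow (A : Matrix d d ℂ) (s t : ℝ) :
    suppPow A s * suppPow A t = suppPow A (s + t) := by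
  rw [suppPow, suppPow, ← cfc_mul _ _ A (continuousOn_spectrum _ _) (continuousOn_spectrum _ _)]
  refine cfc_congr fun x hx => ?_
  split_ifs with h
  · rw [Real.rpow_add h]
  · simp

theorem mul_suppPow_zero_self {A : Matrix d d ℂ} (hA : A.PosSemidef) : A * suppPow A 0 = A := by
  conv_lhs => enter [1]; rw [← suppPow_one hA]
  rw [suppPow_mul_suppPow, add_zero, suppPow_one hA]

/-- The key estimate for the quantum Chernoff bound. -/
theorem trace_sub_trace_posPart_le_chernoffQ {A B : Matrix d d ℂ} (hA : A.PosSemidef)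
    (hB : B.PosSemidef) {s : ℝ} (hs : 0 < s) (hs' : s < 1) :
    A.trace.re - ((A - B) * suppPow (A - B) 0).trace.re ≤ chernoffQ s A B := by
  have hH : (A - B).IsHermitian := hA.isHermitian.sub hB.isHermitian
  set D := (A - B) * suppPow (A - B) 0
  have hD : D.PosSemidef := posSemidef_mul_suppPow_zero hH
  have hBD : (B + D).PosSemidef := hB.add hD
  have hABD : (B + D - A).PosSemidef := by
    convert posSemidef_mul_suppPow_zero_sub hH using 1
    abel
  have hBBD : (B + D - B).PosSemidef := by simpa using hD
  have split {X : Matrix d d ℂ} (hX : X.PosSemidef) :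
      suppPow X s * suppPow X (1 - s) = X := by
    rw [suppPow_mul_suppPow, add_sub_cancel, suppPow_one hX]
  -- `D` is the positive part of `A - B`, so `B + D` dominates both `A` and `B`. Replacing `A` by `B
  -- + D`, one power at a time, bounds `Tr A - Q_s` by `Tr D`.
  have h1 := trace_mul_re_mono (suppPow_posSemidef A s)
    (suppPow_mono hA hABD (sub_pos.mpr hs') (by linarith))
  have h2 := trace_mul_re_nonneg (suppPow_mono hB hBBD (sub_pos.mpr hs') (by linarith))
    (suppPow_mono hA hABD hs hs'.le)
  have h3 := trace_mul_re_mono (suppPow_posSemidef B (1 - s)) (suppPow_mono hB hBBD hs hs'.le)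
  rw [trace_mul_comm] at h2
  simp only [Matrix.sub_mul, Matrix.mul_sub, split hBD, trace_sub, Complex.sub_re, trace_add,
    Complex.add_re] at h2
  rw [trace_mul_comm, split hB, trace_mul_comm] at h3
  rw [split hA] at h1
  rw [chernoffQ]
  linarith

end Powers

/-! ### Single-shot bounds on the optimal error -/

section OptError

variable {d : Type*} [DecidableEq d] {κ : Type*} [Fintype κ]

theorem IsPOVM.one_sub {E : κ → Matrix d d ℂ} (hE : IsPOVM E) (k : κ) :
    (1 - E k).PosSemidef := by
  classical
  have h : (∑ i ∈ Finset.univ.erase k, E i).PosSemidef :=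
    posSemidef_sum _ fun i _ => hE.posSemidef i
  convert hE.sum_le_one.add h using 1
  rw [← Finset.add_sum_erase _ _ (Finset.mem_univ k)]
  abel

theorem isPOVM_zero : IsPOVM (0 : κ → Matrix d d ℂ) :=
  ⟨fun _ => PosSemidef.zero, by simpa using PosSemidef.one⟩

variable [Fintype d]

theorem errorProb_nonneg {A E : κ → Matrix d d ℂ} (hA : ∀ i, (A i).PosSemidef) (hE : IsPOVM E) :
    0 ≤ errorProb A E :=
  Finset.sum_nonneg fun i _ => trace_mul_re_nonneg (hA i) (hE.one_sub i)

theorem optError_le {A E : κ → Matrix d d ℂ} (hA : ∀ i, (A i).PosSemidef) (hE : IsPOVM E) :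
    optError A ≤ errorProb A E :=
  csInf_le ⟨0, by rintro x ⟨F, hF, rfl⟩; exact errorProb_nonneg hA hF⟩ ⟨E, hE, rfl⟩

theorem le_optError {A : κ → Matrix d d ℂ} {b : ℝ} (h : ∀ E, IsPOVM E → b ≤ errorProb A E) :
    b ≤ optError A :=
  le_csInf ⟨_, 0, isPOVM_zero, rfl⟩ (by rintro x ⟨F, hF, rfl⟩; exact h F hF)

theorem optError_nonneg {A : κ → Matrix d d ℂ} (hA : ∀ i, (A i).PosSemidef) : 0 ≤ optError A :=
  le_optError fun _ hE => errorProb_nonneg hA hE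

theorem optError_pair_le {A B T : Matrix d d ℂ} (hA : A.PosSemidef) (hB : B.PosSemidef)
    (hT : T.PosSemidef) (hT' : (1 - T).PosSemidef) :
    optError ![A, B] ≤ (A * (1 - T)).trace.re + (B * T).trace.re := by
  have hE : IsPOVM ![T, 1 - T] :=
    ⟨by simp [Fin.forall_fin_two, hT, hT'], by simpa using PosSemidef.zero⟩
  simpa [errorProb] using optError_le (A := ![A, B]) (by simp [Fin.forall_fin_two, hA, hB]) hE

/-- The test is the projection onto the positive part of `A - B` for `0 < s < 1`; at the endpoints,
a support projection of `A` or `B` attains `Q_s` exactly. -/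
theorem optError_pair_le_chernoffQmin {A B : Matrix d d ℂ} (hA : A.PosSemidef)
    (hB : B.PosSemidef) : optError ![A, B] ≤ chernoffQmin A B := by
  refine le_csInf (Set.Nonempty.image _ ⟨0, by simp⟩) ?_
  rintro _ ⟨s, ⟨hs, hs'⟩, rfl⟩
  have supp (X : Matrix d d ℂ) := suppPow_posSemidef X 0
  have supp' (X : Matrix d d ℂ) := one_sub_suppPow_zero_posSemidef X
  dsimp only
  rcases hs.eq_or_lt with rfl | hs
  · refine (optError_pair_le hA hB (supp A) (supp' A)).trans_eq ?_
    rw [chernoffQ, Matrix.mul_sub, mul_suppPow_zero_self hA, sub_zero, suppPow_one hB,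
      trace_mul_comm (suppPow A 0)]
    simp
  rcases hs'.eq_or_lt with rfl | hs'
  · refine (optError_pair_le hA hB (supp' B) (by simpa using supp B)).trans_eq ?_
    rw [chernoffQ, Matrix.mul_sub B, mul_suppPow_zero_self hB, suppPow_one hA]
    simp
  · refine (optError_pair_le hA hB (supp (A - B)) (supp' (A - B))).trans ?_
    refine le_trans (le_of_eq ?_) (trace_sub_trace_posPart_le_chernoffQ hA hB hs hs')
    simp only [Matrix.sub_mul, Matrix.mul_sub, trace_sub, Complex.sub_re, Matrix.mul_one]
    ring

theorem trace_mul_re_le_optError_pair {A B : Matrix d d ℂ} (hA : A.PosSemidef)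
    (hB : B.PosSemidef) :
    (A * B).trace.re ≤ 2 * (A.trace.re + B.trace.re) * optError ![A, B] := by
  have ht := add_nonneg hA.trace_re_nonneg hB.trace_re_nonneg
  rcases ht.eq_or_lt with h0 | h0
  · have := trace_mul_re_le_of_test hA hB PosSemidef.zero (by simpa using PosSemidef.one)
    simpa [← h0] using this
  rw [← div_le_iff₀' (by positivity)]
  refine le_optError fun E hE => ?_
  rw [div_le_iff₀' (by positivity)]
  refine (trace_mul_re_le_of_test hA hB (hE.posSemidef 1) (hE.one_sub 1)).trans ?_
  refine mul_le_mul_of_nonneg_left ?_ (by positivity)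
  -- The POVM may be incomplete, so `E 1` is only bounded by `1 - E 0`; this suffices.
  have h1 : (1 - E 0 - E 1).PosSemidef := by
    simpa [sub_sub] using hE.sum_le_one
  have h2 : (A * E 1).trace.re ≤ (A * (1 - E 0)).trace.re := trace_mul_re_mono hA h1
  simpa [errorProb] using h2

/-- A projection `P` whose range contains that of one additional hypothesis can be measured before
the other hypotheses are discriminated. -/
theorem optError_snoc_le {r : ℕ} {A : Fin (r + 1) → Matrix d d ℂ} {P : Matrix d d ℂ}
    (hA : ∀ i, (A i).PosSemidef) (hP : P.PosSemidef) (hPP : P * P = P)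
    (hAP : A (Fin.last r) * P = A (Fin.last r)) :
    optError A ≤ 2 * optError (fun i : Fin r => A i.castSucc) +
      3 * ∑ i : Fin r, (A i.castSucc * P).trace.re := by
  have hQ : (1 - P).IsHermitian := isHermitian_one.sub hP.isHermitian
  have hQQ : (1 - P) * (1 - P) = 1 - P := by
    simp [Matrix.mul_sub, Matrix.sub_mul, hPP]
  have hQpos : (1 - P).PosSemidef := by
    have := posSemidef_conjTranspose_mul_self (1 - P)
    rwa [hQ.eq, hQQ] at this
  suffices h : (optError A - 3 * ∑ i : Fin r, (A i.castSucc * P).trace.re) / 2 ≤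
      optError (fun i : Fin r => A i.castSucc) by linarith
  refine le_optError fun E hE => ?_
  obtain ⟨F, hFc, hFl⟩ : ∃ F : Fin (r + 1) → Matrix d d ℂ,
      (∀ i : Fin r, F i.castSucc = (1 - P) * E i * (1 - P)) ∧ F (Fin.last r) = P :=
    ⟨Fin.snoc (α := fun _ => Matrix d d ℂ) (fun i => (1 - P) * E i * (1 - P)) P, by simp, by simp⟩
  have hF : IsPOVM F := by
    refine ⟨fun k => ?_, ?_⟩
    · induction k using Fin.lastCases with
      | last => rwa [hFl]
      | cast i =>
        rw [hFc]
        have := (hE.posSemidef i).conjTranspose_mul_mul_same (1 - P)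
        rwa [hQ.eq] at this
    · have := hE.sum_le_one.conjTranspose_mul_mul_same (1 - P)
      rw [hQ.eq, Matrix.mul_sub (1 - P) 1, Matrix.sub_mul _ _ (1 - P), Matrix.mul_one, hQQ] at this
      rw [Fin.sum_univ_castSucc, hFl]
      simp only [hFc, ← Finset.sum_mul, ← Finset.mul_sum]
      convert this using 1
      abel
  have h := optError_le hA hF
  rw [errorProb, Fin.sum_univ_castSucc, hFl, Matrix.mul_sub, hAP] at h
  have hi (i : Fin r) : (A i.castSucc * (1 - F i.castSucc)).trace.re ≤
      2 * (A i.castSucc * (1 - E i)).trace.re + 3 * (A i.castSucc * P).trace.re := by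
    -- Split `1 - P` as `1 + (-P)`. This costs `2 Tr A_i P`; the summand `P` in `h3` adds one more,
    -- giving the constant 3.
    have h1 := trace_mul_conj_add_le (hA i.castSucc) (hE.one_sub i) isHermitian_one
      hP.isHermitian.neg
    have h2 : (A i.castSucc * (P * (1 - E i) * P)).trace.re ≤ (A i.castSucc * P).trace.re := by
      refine trace_mul_re_mono (hA _) ?_
      have := (hE.posSemidef i).conjTranspose_mul_mul_same P
      rw [hP.isHermitian.eq] at this
      convert this using 1
      rw [Matrix.mul_sub, Matrix.sub_mul, Matrix.mul_one, hPP, sub_sub_cancel]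
    have h3 : 1 - F i.castSucc = P + (1 - P) * (1 - E i) * (1 - P) := by
      rw [hFc, Matrix.mul_sub (1 - P) 1, Matrix.sub_mul _ _ (1 - P), Matrix.mul_one, hQQ]
      abel
    rw [h3, Matrix.mul_add, trace_add, Complex.add_re]
    simp only [Matrix.one_mul, Matrix.mul_one, Matrix.neg_mul, Matrix.mul_neg, neg_neg,
      ← sub_eq_add_neg] at h1
    linarith
  have hsum := Finset.sum_le_sum fun i (_ : i ∈ Finset.univ) => hi i
  rw [Finset.sum_add_distrib, ← Finset.mul_sum, ← Finset.mul_sum] at hsum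
  simp only [Matrix.mul_one, sub_self, trace_zero, Complex.zero_re, add_zero] at h
  rw [errorProb]
  linarith

/-- Write `A` as an outer product. This makes `A / Tr A` idempotent, hence usable as `P`. -/
theorem mul_self_eq_trace_smul_of_rank_eq_one {A : Matrix d d ℂ} (hA : A.rank = 1) :
    A * A = A.trace • A := by
  obtain ⟨v, -, hv⟩ := finrank_eq_one_iff'.mp hA
  have h (j : d) : ∃ c : ℂ, ∀ i, A i j = v.1 i * c := by
    obtain ⟨c, hc⟩ := hv ⟨A *ᵥ Pi.single j 1, Pi.single j 1, rfl⟩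
    refine ⟨c, fun i => ?_⟩
    have := congrFun (congrArg Subtype.val hc) i
    simp at this
    rw [← this, mul_comm]
  choose c hc using h
  have : A = vecMulVec v.1 c := by ext i j; simp [hc, vecMulVec_apply]
  rw [this, trace_vecMulVec, vecMulVec_mul_vecMulVec, dotProduct_comm]
  simp

omit [DecidableEq d] in
theorem trace_re_pos_of_rank_eq_one {A : Matrix d d ℂ} (hA : A.PosSemidef) (h : A.rank = 1) :
    0 < A.trace.re := by
  refine hA.trace_re_nonneg.lt_of_ne fun h0 => ?_
  have : A.trace = 0 := Complex.ext h0.symm (Complex.le_def.mp hA.trace_nonneg).2.symm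
  rw [hA.trace_eq_zero_iff.mp this] at h
  simp at h

theorem optError_snoc_le_of_rank_eq_one {r : ℕ} {A : Fin (r + 1) → Matrix d d ℂ}
    (hA : ∀ i, (A i).PosSemidef) (hr : (A (Fin.last r)).rank = 1) :
    optError A ≤ 2 * optError (fun i : Fin r => A i.castSucc) +
      6 * ∑ i : Fin r, (1 + (∑ j : Fin r, A j.castSucc).trace.re / (A (Fin.last r)).trace.re) *
        optError ![A i.castSucc, A (Fin.last r)] := by
  set B := A (Fin.last r) with hB
  have ha := trace_re_pos_of_rank_eq_one (hA _) hr
  rw [← hB] at ha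
  have hac : B.trace = (B.trace.re : ℂ) :=
    Complex.ext (by simp) (by simpa using (Complex.le_def.mp (hA (Fin.last r)).trace_nonneg).2.symm)
  have hBB := mul_self_eq_trace_smul_of_rank_eq_one hr
  generalize hage : B.trace.re = a at *
  rw [hac] at hBB
  have ha' : (a : ℂ) ≠ 0 := by exact_mod_cast ha.ne'
  have hP : ((a : ℂ)⁻¹ • B).PosSemidef := (hA (Fin.last r)).smul (by
    rw [← Complex.ofReal_inv]; exact_mod_cast (inv_pos.mpr ha).le)
  refine (optError_snoc_le hA hP (by
    rw [Matrix.smul_mul, Matrix.mul_smul, hBB, inv_smul_smul₀ ha']) (by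
    rw [← hB, Matrix.mul_smul, hBB, inv_smul_smul₀ ha'])).trans ?_
  rw [show (6 : ℝ) = 3 * 2 by norm_num, mul_assoc, Finset.mul_sum (a := (2 : ℝ))]
  gcongr with i
  have h1 := trace_mul_re_le_optError_pair (hA i.castSucc) (hA (Fin.last r))
  rw [← hB, hage] at h1
  have h2 : (A i.castSucc).trace.re ≤ (∑ j : Fin r, A j.castSucc).trace.re := by
    rw [trace_sum, Complex.re_sum]
    exact Finset.single_le_sum (f := fun j : Fin r => (A j.castSucc).trace.re)
      (fun j _ => (hA j.castSucc).trace_re_nonneg) (Finset.mem_univ i)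
  have h3 : 0 ≤ optError ![A i.castSucc, B] :=
    optError_nonneg (by simp [Fin.forall_fin_two, hA, hB])
  have h4 : (A i.castSucc * (a : ℂ)⁻¹ • B).trace.re = (A i.castSucc * B).trace.re / a := by
    rw [Matrix.mul_smul, trace_smul, ← Complex.ofReal_inv, smul_eq_mul, Complex.re_ofReal_mul]
    ring
  rw [h4, div_le_iff₀ ha]
  refine h1.trans ?_
  have h5 : 2 * ((1 + (∑ j : Fin r, A j.castSucc).trace.re / a) * optError ![A i.castSucc, B]) * a
      = 2 * (a + (∑ j : Fin r, A j.castSucc).trace.re) * optError ![A i.castSucc, B] := by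
    field_simp
  rw [h5, add_comm a]
  gcongr

end OptError

/-! ### Passage to exponents -/

open ExpGrowth in
theorem pairExponent_le_neg_chernoffDiv {d : ℕ → Type*} [∀ n, Fintype (d n)]
    [∀ n, DecidableEq (d n)] {A B : ∀ n, Matrix (d n) (d n) ℂ} (hA : ∀ n, (A n).PosSemidef)
    (hB : ∀ n, (B n).PosSemidef) : pairExponent A B ≤ -chernoffDiv A B := by
  rw [chernoffDiv, neg_neg]
  refine expGrowthSup_monotone fun n => ENNReal.ofReal_le_ofReal ?_
  convert optError_pair_le_chernoffQmin (hA n) (hB n) using 2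
  ext i
  fin_cases i <;> rfl

theorem pairExponent_le_maxPairExponent {d : ℕ → Type*} [∀ n, Fintype (d n)]
    [∀ n, DecidableEq (d n)] {r : ℕ} (A : Fin r → ∀ n, Matrix (d n) (d n) ℂ) {i j : Fin r}
    (h : i < j) : pairExponent (A i) (A j) ≤ maxPairExponent A :=
  le_iSup₂_of_le i j (le_iSup_of_le h le_rfl)

end StateDiscrimination

open StateDiscrimination ExpGrowth in
theorem mainTheorem10 {d : ℕ → Type*} [∀ n, Fintype (d n)] [∀ n, DecidableEq (d n)]
    (r : ℕ) (A : Fin (r + 1) → ∀ n, Matrix (d n) (d n) ℂ)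
    (hA : ∀ i n, (A i n).PosSemidef)
    (hrank : ∀ n, (A (Fin.last r) n).rank = 1)
    (hbound : StateDiscrimination.upperExponent (fun i : Fin r => A i.castSucc) ≤
      StateDiscrimination.maxPairExponent (fun i : Fin r => A i.castSucc))
    (htrace : ExpGrowth.expGrowthSup (fun n => ENNReal.ofReal
      ((∑ i : Fin r, A i.castSucc n).trace.re / (A (Fin.last r) n).trace.re)) = 0) :
    StateDiscrimination.upperExponent A ≤ StateDiscrimination.maxPairExponent A ∧
      StateDiscrimination.maxPairExponent A ≤ -StateDiscrimination.minChernoffDiv A := by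
  constructor
  · have hmax : maxPairExponent (fun i : Fin r => A i.castSucc) ≤ maxPairExponent A :=
      iSup₂_le fun i j => iSup_le fun h => pairExponent_le_maxPairExponent A (by simpa using h)
    let t : ℕ → ENNReal := fun n => ENNReal.ofReal
      ((∑ i : Fin r, A i.castSucc n).trace.re / (A (Fin.last r) n).trace.re)
    let x : ℕ → ENNReal := fun n => ENNReal.ofReal (optError fun i : Fin r => A i.castSucc n)
    let p : Fin r → ℕ → ENNReal := fun i n =>
      ENNReal.ofReal (optError ![A i.castSucc n, A (Fin.last r) n])
    have hp (i : Fin r) : expGrowthSup (p i) = pairExponent (A i.castSucc) (A (Fin.last r)) := by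
      refine congrArg expGrowthSup (funext fun n => congrArg ENNReal.ofReal ?_)
      congr 1
      ext k
      fin_cases k <;> rfl
    have hle (n : ℕ) : ENNReal.ofReal (optError fun i => A i n) ≤
        6 * (x + ∑ i, ((fun _ => 1) + t) * p i) n := by
      refine (ENNReal.ofReal_le_ofReal
        (optError_snoc_le_of_rank_eq_one (fun i => hA i n) (hrank n))).trans ?_
      have hx : 0 ≤ optError fun i : Fin r => A i.castSucc n :=
        optError_nonneg fun i => hA i.castSucc n
      have ht : 0 ≤ (∑ i : Fin r, A i.castSucc n).trace.re / (A (Fin.last r) n).trace.re :=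
        div_nonneg (Matrix.posSemidef_sum _ fun i _ => hA i.castSucc n).trace_re_nonneg
          (hA _ n).trace_re_nonneg
      have hpp (i : Fin r) : 0 ≤ optError ![A i.castSucc n, A (Fin.last r) n] :=
        optError_nonneg (by simp [Fin.forall_fin_two, hA])
      have hs (i : Fin r) : 0 ≤ (1 + (∑ i : Fin r, A i.castSucc n).trace.re /
          (A (Fin.last r) n).trace.re) * optError ![A i.castSucc n, A (Fin.last r) n] :=
        mul_nonneg (by linarith) (hpp i)
      rw [ENNReal.ofReal_add (by positivity)
          (mul_nonneg (by norm_num) (Finset.sum_nonneg fun i _ => hs i)),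
        ENNReal.ofReal_mul (by norm_num), ENNReal.ofReal_mul (by norm_num),
        ENNReal.ofReal_sum_of_nonneg fun i _ => hs i, Pi.add_apply, mul_add, Finset.sum_apply]
      gcongr with i
      · simp only [ENNReal.ofReal_ofNat]; norm_num
      · simp
      · rw [ENNReal.ofReal_mul (by linarith), ENNReal.ofReal_add (by norm_num) ht]
        simp [t, p]
    refine (expGrowthSup_le_of_eventually_le (b := 6) (by simp) (.of_forall hle)).trans ?_
    rw [expGrowthSup_add, expGrowthSup_sum]
    refine sup_le (hbound.trans hmax) (iSup₂_le fun i _ => ?_)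
    -- The trace hypothesis makes the prefactor of the pair errors subexponential.
    have h1 : expGrowthSup ((fun _ => 1) + t) = 0 := by
      rw [expGrowthSup_add, expGrowthSup_const one_ne_zero ENNReal.one_ne_top, htrace, sup_idem]
    refine (expGrowthSup_mul_le (.inl (by simp [h1])) (.inl (by simp [h1]))).trans ?_
    rw [h1, zero_add, hp]
    exact pairExponent_le_maxPairExponent A (Fin.castSucc_lt_last i)
  · refine iSup₂_le fun i j => iSup_le fun h =>
      (pairExponent_le_neg_chernoffDiv (hA i) (hA j)).trans ?_
    exact EReal.neg_le_neg_iff.mpr (iInf₂_le_of_le i j (iInf_le_of_le h le_rfl))
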